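/- Let $E$ be a finite set (for example $E=\{1,\dots,n\}$), and let $\mathbb{TP}(E)=\mathbb R^E/\mathbb R(1,\dots,1)$. For a matroid $\mathfrak G$ on the ground set $E$, let $\Delta(\mathfrak G)\subset\mathbb R^E$ be its matroid polytope, the convex hull of the vectors $e_B=\sum_{i\in B}e_i$, where $B$ runs over the bases of $\mathfrak G$. The (outer) normal fan of $\Delta(\mathfrak G)$ consists of the cones $N_F=\{w\in\mathbb R^E : \langle w,y\rangle\le\langle w,x\rangle \text{ for all } x\in F,\ y\in\Delta(\mathfrak G)\}$, where $F$ runs over the nonempty faces of $\Delta(\mathfrak G)$. Call a face $F$ loop-free if every $i\in E$ lies in some basis $B$ of $\mathfrak G$ with $e_B\in F$. The Bergman fan $B(\mathfrak G)\subseteq\mathbb{TP}(E)$ is the image of the union of the cones $N_F$ over the loop-free faces $F$ of $\Delta(\mathfrak G)$. Let also $K(\mathfrak G)\subseteq\mathbb{TP}(E)$ be the image of the union of all cones of codimension at least one in the normal fan of $\Delta(\mathfrak G)$. Let $\mathfrak G_1$ and $\mathfrak G_2$ be loop-free matroids on the ground set $E$. 1. If $B(\mathfrak G_1)=B(\mathfrak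 G_2)$, then $\mathfrak G_1=\mathfrak G_2$. 2. Likewise, if $K(\mathfrak G_1)=K(\mathfrak G_2)$, then $\mathfrak G_1=\mathfrak G_2$. -/

import Mathlib

namespace BergmanFan

noncomputable section

/-- The 0/1 vector `∑ i ∈ S, e_i`. -/
def indicatorVec {ι : Type*} (S : Set ι) : ι → ℝ := S.indicator (fun _ => 1)

/-- The convex hull of the indicator vectors of the bases of `M`. -/
def matroidPolytope {ι : Type*} (M : Matroid ι) : Set (ι → ℝ) :=
  convexHull ℝ {v | ∃ B : Set ι, M.IsBase B ∧ v = indicatorVec B}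

/-- The face of `P` on which the linear functional `⟨w, ·⟩` is maximal. -/
def face {ι : Type*} [Fintype ι] (P : Set (ι → ℝ)) (w : ι → ℝ) : Set (ι → ℝ) :=
  {x | x ∈ P ∧ ∀ y ∈ P, dotProduct w y ≤ dotProduct w x}

/-- The (outer) normal cone of `P` along `F`: all functionals that are maximal over `P` at every
point of `F`. -/
def normalCone {ι : Type*} [Fintype ι] (P F : Set (ι → ℝ)) : Set (ι → ℝ) :=
  {w | ∀ x ∈ F, ∀ y ∈ P, dotProduct w y ≤ dotProduct w x}

/-- The (outer) normal fan of a polytope `P`, as a collection of cones: the normal cones of the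
nonempty faces of `P`. -/
def normalFan {ι : Type*} [Fintype ι] (P : Set (ι → ℝ)) : Set (Set (ι → ℝ)) :=
  {C | ∃ F : Set (ι → ℝ), F.Nonempty ∧ (∃ u : ι → ℝ, F = face P u) ∧ C = normalCone P F}

/-- The codimension of a cone, that is, of its linear span. -/
def codim {ι : Type*} [Fintype ι] (C : Set (ι → ℝ)) : ℕ :=
  Module.finrank ℝ ((ι → ℝ) ⧸ Submodule.span ℝ C)

/-- The tropical projective space `ℝ^ι / ℝ(1,…,1)`. -/
abbrev TropProj (ι : Type*) : Type _ :=
  (ι → ℝ) ⧸ Submodule.span ℝ {(fun _ => 1 : ι → ℝ)}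

/-- The quotient map `ℝ^ι → ℝ^ι / ℝ(1,…,1)`. -/
def toTropProj (ι : Type*) : (ι → ℝ) →ₗ[ℝ] TropProj ι :=
  Submodule.mkQ _

/-- A face `F` of the matroid polytope of `M` is the matroid polytope of the matroid whose bases
are the bases `B` of `M` with `e_B ∈ F`. `LoopFreeFace M F` says that this matroid has no loop:
each element of the ground set lies in one of these bases. -/
def LoopFreeFace {ι : Type*} (M : Matroid ι) (F : Set (ι → ℝ)) : Prop :=
  ∀ i ∈ M.E, ∃ B : Set ι, M.IsBase B ∧ indicatorVec B ∈ F ∧ i ∈ B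

/-- The Bergman fan of `M`: the image in tropical projective space of the union of those cones of
the normal fan of the matroid polytope that are normal cones of loop-free faces. -/
def bergmanFan {ι : Type*} [Fintype ι] (M : Matroid ι) : Set (TropProj ι) :=
  toTropProj ι '' ⋃₀ {C | ∃ F : Set (ι → ℝ), F.Nonempty ∧
    (∃ u : ι → ℝ, F = face (matroidPolytope M) u) ∧ LoopFreeFace M F ∧
    C = normalCone (matroidPolytope M) F}

/-- The image in tropical projective space of the union of all the cones of codimension at least
one in the normal fan of the matroid polytope. -/
def normalFanSkeleton {ι : Type*} [Fintype ι] (M : Matroid ι) : Set (TropProj ι) :=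
  toTropProj ι '' ⋃₀ {C | C ∈ normalFan (matroidPolytope M) ∧ 1 ≤ codim C}

end

end BergmanFan

namespace BergmanFan

open Matroid Set

variable {ι : Type*} {M M₁ M₂ : Matroid ι} {B B' F S : Set ι} {e f i j : ι}

/-! ### Exchange in a base -/

/-! All bases have the same size, so whether the class of `w` lies in either fan depends only on the
bases of maximal `w`-weight: for the Bergman fan they must cover the ground set, for the skeleton
there must be at least two. By the greedy principle `IsMaxBase.subset_closure_inter`, such bases
span every superlevel set of `w`, so well-chosen weights recover the matroid. For the Bergman fan,
the indicator vector of `F` tests whether `F` is a flat, and flats determine the closure operator.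
For the skeleton, take a weight in which only `i` and `j` tie and `F` is the set of heavier
elements: it tests whether `i` and `j` are parallel nonloops of `M / F`. These pairs determine all
closures, built up one element at a time from the empty closure of `∅`. -/

/-- An element not spanned by the part of a base inside `S` can be exchanged for an element of the
base outside `S`. -/
lemma exists_exchange_of_notMem_closure_inter (hB : M.IsBase B) (he : e ∈ M.E)
    (heS : e ∉ M.closure (B ∩ S)) :
    ∃ f ∈ B, f ∉ S ∧ M.IsBase (insert e (B \ {f})) := by
  by_cases heB : e ∈ B
  · refine ⟨e, heB, fun h ↦ heS (M.mem_closure_of_mem' ⟨heB, h⟩ he), ?_⟩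
    simpa [insert_eq_of_mem heB] using hB
  have hI : M.Indep (insert e (B ∩ S)) :=
    (hB.indep.subset inter_subset_left).insert_indep_iff.2 (Or.inl ⟨he, heS⟩)
  obtain ⟨B', hB', hIB', hB'I⟩ := hI.exists_isBase_subset_union_isBase hB
  have hne : ¬ B ⊆ B' := fun h ↦ heB (hB.eq_of_subset_isBase hB' h ▸ hIB' (mem_insert _ _))
  obtain ⟨f, hfB, hfB'⟩ := not_subset.1 hne
  refine ⟨f, hfB, fun hfS ↦ hfB' (hIB' (Or.inr ⟨hfB, hfS⟩)), ?_⟩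
  refine hB.exchange_base_of_notMem_closure hfB (fun hcl ↦ ?_) he
  -- `B'` adds only `e` to `B \ {f}`, so if `e` were spanned by `B \ {f}`, so would be the base
  -- `B'`, hence `f`.
  have hsub : B' ⊆ M.closure (B \ {f}) := by
    intro x hx
    by_cases hxe : x = e
    · exact hxe ▸ hcl
    · have hxB : x ∈ B := by
        rcases hB'I hx with (h | h) | h
        · exact absurd h hxe
        · exact h.1
        · exact h
      refine M.mem_closure_of_mem' ⟨hxB, ?_⟩ (hB.subset_ground hxB)
      rintro rfl
      exact hfB' hx
  have := M.closure_subset_closure_of_subset_closure hsub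
  rw [hB'.closure_eq] at this
  exact hB.indep.notMem_closure_sdiff_of_mem hfB (this (hB.subset_ground hfB))

lemma notMem_closure_of_mem_of_subset (hB : M.Indep B) (he : e ∈ B) (hS : S ⊆ B) (heS : e ∉ S) :
    e ∉ M.closure S := fun h ↦
  hB.notMem_closure_sdiff_of_mem he (M.closure_subset_closure (subset_sdiff_singleton hS heS) h)

/-- Nonloops `i` and `j` of the contraction `M / F` are parallel there. -/
def ParallelOver (M : Matroid ι) (F : Set ι) (i j : ι) : Prop :=
  i ∉ M.closure F ∧ j ∉ M.closure F ∧ j ∈ M.closure (insert i F)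

lemma ParallelOver.symm (h : ParallelOver M F i j) : ParallelOver M F j i :=
  ⟨h.2.1, h.1, (closure_exchange ⟨h.2.2, h.2.1⟩).1⟩

/-- Loopless matroids with the same parallel pairs in all contractions have comparable closures. -/
lemma closure_subset_of_parallelOver [Finite ι] (hE₁ : M₁.E = univ) (hE₂ : M₂.E = univ)
    (hM₁ : M₁.Loopless)
    (h : ∀ F i j, i ∉ F → j ∉ F → i ≠ j → ParallelOver M₁ F i j → ParallelOver M₂ F i j)
    (F : Set ι) : M₁.closure F ⊆ M₂.closure F := by
  induction F, F.toFinite using Set.Finite.induction_on with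
  | empty => simp [closure_empty]
  | @insert f F hf _ ih =>
    intro e he
    have hsub : M₁.closure F ⊆ M₂.closure (insert f F) :=
      ih.trans (M₂.closure_subset_closure (subset_insert _ _))
    have hmem : ∀ x, x ∉ M₁.closure F → x ∉ F := fun x hx hxF ↦
      hx (M₁.mem_closure_of_mem' hxF (hE₁ ▸ mem_univ x))
    by_cases heF : e ∈ M₁.closure F
    · exact hsub heF
    by_cases hfF : f ∈ M₁.closure F
    · rw [closure_insert_eq_of_mem_closure hfF] at he
      exact absurd he heF
    obtain rfl | hne := eq_or_ne f e
    · exact M₂.mem_closure_of_mem' (mem_insert _ _) (hE₂ ▸ mem_univ _)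
    -- The elements that enter the closure when `f` is added to `F` are exactly those parallel to
    -- `f` over `F`.
    exact (h F f e hf (hmem e heF) hne ⟨hfF, heF, he⟩).2.2

lemma eq_of_parallelOver_iff [Finite ι] (hE₁ : M₁.E = univ) (hE₂ : M₂.E = univ)
    (hM₁ : M₁.Loopless) (hM₂ : M₂.Loopless)
    (h : ∀ F i j, i ∉ F → j ∉ F → i ≠ j → (ParallelOver M₁ F i j ↔ ParallelOver M₂ F i j)) :
    M₁ = M₂ :=
  ext_closure fun F ↦
    (closure_subset_of_parallelOver hE₁ hE₂ hM₁ (fun F i j hi hj hij ↦ (h F i j hi hj hij).1)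
      F).antisymm
    (closure_subset_of_parallelOver hE₂ hE₁ hM₂ (fun F i j hi hj hij ↦ (h F i j hi hj hij).2) F)

/-! ### Bases of maximal weight -/

lemma indicatorVec_injective : Function.Injective (indicatorVec : Set ι → ι → ℝ) :=
  fun _ _ h ↦ indicator_one_inj ℝ h

lemma indicatorVec_mem_matroidPolytope (hB : M.IsBase B) : indicatorVec B ∈ matroidPolytope M :=
  subset_convexHull ℝ _ ⟨B, hB, rfl⟩

variable [Fintype ι] {w : ι → ℝ}

/-- A base of maximal weight for the weight function `w`. -/
def IsMaxBase (M : Matroid ι) (w : ι → ℝ) (B : Set ι) : Prop :=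
  M.IsBase B ∧ ∀ B', M.IsBase B' → w ⬝ᵥ indicatorVec B' ≤ w ⬝ᵥ indicatorVec B

lemma exists_isMaxBase (M : Matroid ι) (w : ι → ℝ) : ∃ B, IsMaxBase M w B := by
  obtain ⟨B, hB, hmax⟩ := Set.exists_max_image {B | M.IsBase B} (fun B ↦ w ⬝ᵥ indicatorVec B)
    (Set.toFinite _) M.exists_isBase
  exact ⟨B, hB, hmax⟩

lemma dotProduct_indicatorVec_exchange (w : ι → ℝ) (he : e ∉ B) (hf : f ∈ B) :
    w ⬝ᵥ indicatorVec (insert e (B \ {f})) = w ⬝ᵥ indicatorVec B + w e - w f := by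
  classical
  have : (indicatorVec (insert e (B \ {f})) : ι → ℝ) =
      indicatorVec B + Pi.single e 1 - Pi.single f 1 := by
    ext x
    have hef : e ≠ f := fun h ↦ he (h ▸ hf)
    by_cases hxe : x = e
    · subst hxe
      simp [indicatorVec, he, hef]
    by_cases hxf : x = f
    · subst hxf
      simp [indicatorVec, hf, hxe]
    by_cases hxB : x ∈ B <;> simp [indicatorVec, hxe, hxf, hxB]
  rw [this, dotProduct_sub, dotProduct_add]
  simp

lemma IsMaxBase.exchange (h : IsMaxBase M w B) (he : e ∉ B) (hf : f ∈ B) (hef : w e = w f)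
    (hB' : M.IsBase (insert e (B \ {f}))) : IsMaxBase M w (insert e (B \ {f})) := by
  refine ⟨hB', fun B'' hB'' ↦ (h.2 B'' hB'').trans_eq ?_⟩
  rw [dotProduct_indicatorVec_exchange w he hf, hef]
  ring

/-- A base of maximal weight spans every superlevel set of the weight function. -/
lemma IsMaxBase.subset_closure_inter (h : IsMaxBase M w B) (hE : M.E = univ)
    (hS : ∀ x ∈ S, ∀ y ∉ S, w y < w x) : S ⊆ M.closure (B ∩ S) := by
  intro e heS
  by_contra hcl
  have heE : e ∈ M.E := hE ▸ mem_univ e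
  have heB : e ∉ B := fun heB ↦ hcl (M.mem_closure_of_mem' ⟨heB, heS⟩ heE)
  obtain ⟨f, hfB, hfS, hB'⟩ := exists_exchange_of_notMem_closure_inter h.1 heE hcl
  have h1 := h.2 _ hB'
  rw [dotProduct_indicatorVec_exchange w heB hfB] at h1
  linarith [hS e heS f hfS]

lemma IsMaxBase.closure_inter (h : IsMaxBase M w B) (hE : M.E = univ)
    (hS : ∀ x ∈ S, ∀ y ∉ S, w y < w x) : M.closure (B ∩ S) = M.closure S :=
  (M.closure_subset_closure inter_subset_right).antisymm
    (M.closure_subset_closure_of_subset_closure (h.subset_closure_inter hE hS))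

/-- An element that has a weight of its own lies in a base of maximal weight if and only if it is
not spanned by the heavier elements. -/
lemma IsMaxBase.mem_iff (h : IsMaxBase M w B) (hE : M.E = univ) (he : ∀ x, w x = w e → x = e) :
    e ∈ B ↔ e ∉ M.closure {x | w e < w x} := by
  have hS : ∀ x ∈ {x | w e < w x}, ∀ y ∉ {x | w e < w x}, w y < w x :=
    fun x hx y hy ↦ (not_lt.1 hy).trans_lt hx
  have hS' : ∀ x ∈ {x | w e ≤ w x}, ∀ y ∉ {x | w e ≤ w x}, w y < w x :=
    fun x hx y hy ↦ (not_le.1 hy).trans_le hx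
  rw [← h.closure_inter hE hS]
  constructor
  · intro heB
    exact notMem_closure_of_mem_of_subset h.1.indep heB inter_subset_left
      (fun h ↦ lt_irrefl (w e) h.2)
  · intro hcl
    by_contra heB
    apply hcl
    refine M.closure_subset_closure ?_ (h.subset_closure_inter hE hS' (le_refl (w e)))
    rintro x ⟨hxB, hx⟩
    exact ⟨hxB, lt_of_le_of_ne hx fun hex ↦ heB (he x hex.symm ▸ hxB)⟩

/-- If only `i` and `j` share a weight, then bases of maximal weight are not unique exactly when
`i` and `j` are parallel nonloops after contracting the heavier elements. -/
lemma exists_isMaxBase_ne_iff (hE : M.E = univ) (hij : i ≠ j) (hw : w i = w j)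
    (hinj : ∀ x y, w x = w y → x = y ∨ (x = i ∨ x = j) ∧ (y = i ∨ y = j)) :
    (∃ B B', IsMaxBase M w B ∧ IsMaxBase M w B' ∧ B ≠ B') ↔
      ParallelOver M {x | w i < w x} i j := by
  set F := {x | w i < w x} with hF
  set G := {x | w i ≤ w x} with hG
  have hGF : G = insert i (insert j F) := by
    ext x
    simp only [hG, hF, mem_ofPred_eq, mem_insert_iff]
    constructor
    · intro hx
      rcases hx.eq_or_lt with h | h
      · rcases hinj _ _ h with h | h
        · exact Or.inl h.symm
        · tauto
      · exact Or.inr (Or.inr h)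
    · rintro (rfl | rfl | h)
      exacts [le_rfl, hw.le, h.le]
  have hFl : ∀ x ∈ F, ∀ y ∉ F, w y < w x := fun x hx y hy ↦ (not_lt.1 hy).trans_lt hx
  have hGl : ∀ x ∈ G, ∀ y ∉ G, w y < w x := fun x hx y hy ↦ (not_le.1 hy).trans_le hx
  have hiF : i ∉ F := lt_irrefl (w i)
  have hjF : j ∉ F := fun h : w i < w j ↦ h.ne hw
  have hiG : i ∈ G := le_refl (w i)
  have hjG : j ∈ G := hw.le
  constructor
  · rintro ⟨B, B', hB, hB', hne⟩
    -- Away from `i` and `j` weights are unique, so the greedy rule leaves no choice.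
    have hagree : ∀ x, x ≠ i → x ≠ j → (x ∈ B ↔ x ∈ B') := by
      intro x hxi hxj
      have hx : ∀ y, w y = w x → y = x := fun y hy ↦ by
        rcases hinj y x hy with h | h
        · exact h
        · tauto
      rw [hB.mem_iff hE hx, hB'.mem_iff hE hx]
    have hF' : B ∩ F = B' ∩ F := by
      ext x
      simp only [mem_inter_iff, and_congr_left_iff]
      exact fun hx ↦ hagree x (fun h ↦ hiF (h ▸ hx)) (fun h ↦ hjF (h ▸ hx))
    have key : ∀ (B B' : Set ι), IsMaxBase M w B → IsMaxBase M w B' →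
        (∀ x, x ≠ i → x ≠ j → (x ∈ B ↔ x ∈ B')) → ∀ k l, (k = i ∧ l = j ∨ k = j ∧ l = i) →
        k ∈ B → k ∉ B' → ParallelOver M F k l := by
      intro B B' hB hB' hagree k l hkl hkB hkB'
      have hkF : k ∉ F := by rcases hkl with ⟨rfl, rfl⟩ | ⟨rfl, rfl⟩ <;> assumption
      have hlF : l ∉ F := by rcases hkl with ⟨rfl, rfl⟩ | ⟨rfl, rfl⟩ <;> assumption
      have hlG : l ∈ G := by rcases hkl with ⟨rfl, rfl⟩ | ⟨rfl, rfl⟩ <;> assumption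
      have hlB' : l ∈ B' := by
        by_contra hlB'
        refine hkB' ((hB'.1.eq_of_subset_isBase hB.1 fun x hx ↦ ?_) ▸ hkB)
        have : x ≠ k := fun h ↦ hkB' (h ▸ hx)
        have : x ≠ l := fun h ↦ hlB' (h ▸ hx)
        exact (hagree x (by grind) (by grind)).2 hx
      have hlB : l ∉ B := by
        intro hlB
        refine hkB' ((hB'.1.eq_of_subset_isBase hB.1 fun x hx ↦ ?_) ▸ hkB)
        by_cases hxl : x = l
        · exact hxl ▸ hlB
        have : x ≠ k := fun h ↦ hkB' (h ▸ hx)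
        exact (hagree x (by grind) (by grind)).2 hx
      refine ⟨?_, ?_, ?_⟩
      · rw [← hB.closure_inter hE hFl]
        exact notMem_closure_of_mem_of_subset hB.1.indep hkB inter_subset_left (hkF ·.2)
      · rw [← hB'.closure_inter hE hFl]
        exact notMem_closure_of_mem_of_subset hB'.1.indep hlB' inter_subset_left (hlF ·.2)
      · refine M.closure_subset_closure ?_ (hB.subset_closure_inter hE hGl hlG)
        rw [hGF]
        rintro x ⟨hxB, hx⟩
        have : x ≠ l := fun h ↦ hlB (h ▸ hxB)
        simp only [mem_insert_iff] at hx ⊢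
        grind
    have hsub : ¬ B ⊆ B' := fun h ↦ hne (hB.1.eq_of_subset_isBase hB'.1 h)
    obtain ⟨k, hkB, hkB'⟩ := not_subset.1 hsub
    by_cases hki : k = i
    · exact key B B' hB hB' hagree i j (by simp) (hki ▸ hkB) (hki ▸ hkB')
    by_cases hkj : k = j
    · exact (key B B' hB hB' hagree j i (by simp) (hkj ▸ hkB) (hkj ▸ hkB')).symm
    · exact absurd ((hagree k hki hkj).1 hkB) hkB'
  · intro hp
    obtain ⟨B, hB⟩ := exists_isMaxBase M w
    have hFB := hB.closure_inter hE hFl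
    have key : ∀ k l, (k = i ∧ l = j ∨ k = j ∧ l = i) → ParallelOver M F k l → k ∈ B →
        ∃ B B', IsMaxBase M w B ∧ IsMaxBase M w B' ∧ B ≠ B' := by
      intro k l hkl hp hkB
      have hkF : k ∉ F := by rcases hkl with ⟨rfl, rfl⟩ | ⟨rfl, rfl⟩ <;> assumption
      have hwkl : w l = w k := by
        rcases hkl with ⟨rfl, rfl⟩ | ⟨rfl, rfl⟩
        exacts [hw.symm, hw]
      have hlk : k ∈ M.closure (insert l (B ∩ F)) := by
        rw [closure_insert_congr_right hFB]
        exact hp.symm.2.2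
      have hsub : B ∩ F ⊆ B \ {k} := subset_sdiff_singleton inter_subset_left (hkF ·.2)
      -- Otherwise `B \ {k}` would span `l` and `B ∩ F`, hence `k`, against independence of `B`.
      have hl : l ∉ M.closure (B \ {k}) := by
        intro hl
        apply hB.1.indep.notMem_closure_sdiff_of_mem hkB
        rw [← closure_insert_eq_of_mem_closure hl]
        exact M.closure_subset_closure (insert_subset_insert hsub) hlk
      have hlB : l ∉ B := by
        intro hlB
        refine hl (M.mem_closure_of_mem' ⟨hlB, ?_⟩ (hE ▸ mem_univ l))
        rintro rfl
        exact hij (by grind)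
      refine ⟨B, _, hB, hB.exchange hlB hkB hwkl
        (hB.1.exchange_base_of_notMem_closure hkB hl (hE ▸ mem_univ l)), fun h ↦ hlB ?_⟩
      rw [h]
      exact mem_insert _ _
    by_cases hiB : i ∈ B
    · exact key i j (by simp) hp hiB
    by_cases hjB : j ∈ B
    · exact key j i (by simp) hp.symm hjB
    -- With neither `i` nor `j` in `B`, already `B ∩ F` spans `i`, so `i` would be a loop of `M /
    -- F`.
    exfalso
    apply hp.1
    rw [← hFB]
    refine M.closure_subset_closure ?_ (hB.subset_closure_inter hE hGl hiG)
    rw [hGF]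
    rintro x ⟨hxB, rfl | rfl | hx⟩
    exacts [absurd hxB hiB, absurd hxB hjB, ⟨hxB, hx⟩]

/-- A weight function for which only `i` and `j` share a weight and for which `F` is the set of
elements heavier than `i` and `j`. -/
lemma exists_weight (hi : i ∉ F) (hj : j ∉ F) : ∃ w : ι → ℝ, w i = w j ∧
    (∀ x y, w x = w y → x = y ∨ (x = i ∨ x = j) ∧ (y = i ∨ y = j)) ∧ {x | w i < w x} = F := by
  classical
  -- The shift by 1 keeps the weights on `F` strictly above, and the remaining ones strictly below,
  -- the tie value 0.
  let n : ι → ℝ := fun x ↦ ((Fintype.equivFin ι x : ℕ) : ℝ) + 1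
  have hn : ∀ x, 0 < n x := fun x ↦ by positivity
  have hninj : ∀ x y, n x = n y → x = y := fun x y h ↦ by
    simpa [n, Fin.val_inj] using h
  refine ⟨fun x ↦ if x ∈ F then n x else if x = i ∨ x = j then 0 else -n x, ?_, ?_, ?_⟩
  · simp [hi, hj]
  · intro x y h
    have hx := hn x
    have hy := hn y
    have := hninj x y
    dsimp only at h
    split_ifs at h <;> first | (right; tauto) | (left; apply this; linarith)
  · ext x
    have hx := hn x
    simp only [hi, if_false, true_or, if_true, mem_ofPred_eq]
    split_ifs <;> simp_all [hx.le]

/-! ### Polytopes and cones -/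

lemma dotProduct_le_of_mem_matroidPolytope {c : ℝ}
    (h : ∀ B, M.IsBase B → w ⬝ᵥ indicatorVec B ≤ c) {y : ι → ℝ} (hy : y ∈ matroidPolytope M) :
    w ⬝ᵥ y ≤ c := by
  refine convexHull_min (t := {y | w ⬝ᵥ y ≤ c}) ?_ ?_ hy
  · rintro _ ⟨B, hB, rfl⟩
    exact h B hB
  · exact convex_halfSpace_le ⟨dotProduct_add w, fun c y ↦ dotProduct_smul c w y⟩ c

lemma IsMaxBase.mem_face (h : IsMaxBase M w B) : indicatorVec B ∈ face (matroidPolytope M) w :=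
  ⟨indicatorVec_mem_matroidPolytope h.1, fun _ hy ↦ dotProduct_le_of_mem_matroidPolytope h.2 hy⟩

lemma isMaxBase_of_mem_normalCone {P : Set (ι → ℝ)} (hw : w ∈ normalCone (matroidPolytope M) P)
    (hB : M.IsBase B) (h : indicatorVec B ∈ P) : IsMaxBase M w B :=
  ⟨hB, fun _ hB' ↦ hw _ h _ (indicatorVec_mem_matroidPolytope hB')⟩

lemma mem_normalCone_face (P : Set (ι → ℝ)) (w : ι → ℝ) : w ∈ normalCone P (face P w) :=
  fun _ hx y hy ↦ hx.2 y hy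

lemma face_nonempty (M : Matroid ι) (w : ι → ℝ) : (face (matroidPolytope M) w).Nonempty :=
  let ⟨_, hB⟩ := exists_isMaxBase M w
  ⟨_, hB.mem_face⟩

lemma one_dotProduct_indicatorVec (B : Set ι) :
    (fun _ ↦ 1 : ι → ℝ) ⬝ᵥ indicatorVec B = B.ncard := by
  classical
  simp [dotProduct, indicatorVec, indicator_apply, Set.ncard_eq_toFinset_card']

/-- Adding a constant to `w` shifts the weight of every base equally, because bases are
equicardinal. -/
lemma IsMaxBase.of_toTropProj_eq {w' : ι → ℝ} (h : IsMaxBase M w B)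
    (hw : toTropProj ι w = toTropProj ι w') : IsMaxBase M w' B := by
  obtain ⟨c, hc⟩ := Submodule.mem_span_singleton.1 ((Submodule.Quotient.eq _).1 hw)
  have hw' : w' = w - c • fun _ ↦ 1 := by rw [hc]; abel
  refine ⟨h.1, fun B' hB' ↦ ?_⟩
  rw [hw', sub_dotProduct, sub_dotProduct, smul_dotProduct, smul_dotProduct,
    one_dotProduct_indicatorVec, one_dotProduct_indicatorVec, hB'.ncard_eq_ncard_of_isBase h.1]
  linarith [h.2 B' hB']

/-! ### Membership in the two fans in terms of maximal bases -/

lemma toTropProj_mem_bergmanFan_iff (M : Matroid ι) (w : ι → ℝ) :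
    toTropProj ι w ∈ bergmanFan M ↔ ∀ i ∈ M.E, ∃ B, IsMaxBase M w B ∧ i ∈ B := by
  constructor
  · rintro ⟨w', ⟨_, ⟨P, -, -, hloop, rfl⟩, hw'⟩, hww'⟩ i hi
    obtain ⟨B, hB, hBP, hiB⟩ := hloop i hi
    exact ⟨B, (isMaxBase_of_mem_normalCone hw' hB hBP).of_toTropProj_eq hww', hiB⟩
  · intro h
    refine ⟨w, ⟨_, ⟨_, face_nonempty M w, ⟨w, rfl⟩, fun i hi ↦ ?_, rfl⟩,
      mem_normalCone_face _ w⟩, rfl⟩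
    obtain ⟨B, hB, hiB⟩ := h i hi
    exact ⟨B, hB.1, hB.mem_face, hiB⟩

/-- A unique base of maximal weight remains of maximal weight under small perturbations of the
weight function. -/
lemma IsMaxBase.exists_perturb (h : IsMaxBase M w B) (huniq : ∀ B', IsMaxBase M w B' → B' = B)
    (v : ι → ℝ) : ∃ ε : ℝ, 0 < ε ∧ IsMaxBase M (w + ε • v) B := by
  have hev : ∀ᶠ ε : ℝ in nhdsWithin 0 (Ioi 0), ∀ B', M.IsBase B' →
      (w + ε • v) ⬝ᵥ indicatorVec B' ≤ (w + ε • v) ⬝ᵥ indicatorVec B := by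
    refine Filter.eventually_all.2 fun B' ↦ ?_
    by_cases hB' : M.IsBase B'
    swap
    · simp [hB']
    obtain rfl | hne := eq_or_ne B' B
    · simp
    have hlt : w ⬝ᵥ indicatorVec B' < w ⬝ᵥ indicatorVec B := by
      refine lt_of_not_ge fun hle ↦ hne (huniq B' ⟨hB', fun B'' hB'' ↦ (h.2 B'' hB'').trans hle⟩)
    have hcont : ∀ C : Set ι, Continuous fun ε : ℝ ↦ (w + ε • v) ⬝ᵥ indicatorVec C := by
      intro C
      simp only [add_dotProduct, smul_dotProduct]
      fun_prop
    refine nhdsWithin_le_nhds ?_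
    filter_upwards [(isOpen_lt (hcont B') (hcont B)).mem_nhds (by simpa using hlt)] with ε hε _
    exact le_of_lt hε
  obtain ⟨ε, hε, hpos⟩ := (hev.and self_mem_nhdsWithin).exists
  exact ⟨ε, hpos, h.1, hε⟩

/-- A unique base of maximal weight is the only point at which the weight is maximal on the
matroid polytope. -/
lemma IsMaxBase.eq_indicatorVec (h : IsMaxBase M w B) (huniq : ∀ B', IsMaxBase M w B' → B' = B)
    {x : ι → ℝ} (hx : x ∈ matroidPolytope M) (hxw : w ⬝ᵥ indicatorVec B ≤ w ⬝ᵥ x) :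
    x = indicatorVec B := by
  -- Perturbing towards `x` itself forces the squared length of `x - indicatorVec B` to be at most
  -- 0.
  obtain ⟨ε, hε, hmax⟩ := h.exists_perturb huniq (x - indicatorVec B)
  have h1 := dotProduct_le_of_mem_matroidPolytope hmax.2 hx
  simp only [add_dotProduct, smul_dotProduct, smul_eq_mul] at h1
  have h2 : ε * ((x - indicatorVec B) ⬝ᵥ (x - indicatorVec B)) ≤ 0 := by
    rw [dotProduct_sub, mul_sub]
    linarith
  have h3 : (x - indicatorVec B) ⬝ᵥ (x - indicatorVec B) = 0 :=
    le_antisymm (nonpos_of_mul_nonpos_right h2 hε)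
      (Finset.sum_nonneg fun i _ ↦ mul_self_nonneg _)
  exact sub_eq_zero.1 (dotProduct_self_eq_zero.1 h3)

lemma one_le_codim_iff (C : Set (ι → ℝ)) : 1 ≤ codim C ↔ Submodule.span ℝ C ≠ ⊤ := by
  rw [codim, Nat.one_le_iff_ne_zero, ← Nat.pos_iff_ne_zero, Module.finrank_pos_iff,
    Submodule.Quotient.nontrivial_iff]

/-- If the maximal base is unique, small perturbations of the weight stay in the cone, which
therefore spans the whole space; two maximal bases confine their cone to the hyperplane orthogonal
to their difference. -/
lemma toTropProj_mem_normalFanSkeleton_iff (M : Matroid ι) (w : ι → ℝ) :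
    toTropProj ι w ∈ normalFanSkeleton M ↔
      ∃ B B', IsMaxBase M w B ∧ IsMaxBase M w B' ∧ B ≠ B' := by
  constructor
  · rintro ⟨w', ⟨_, ⟨⟨P, -, ⟨u, rfl⟩, rfl⟩, hcodim⟩, hw'⟩, hww'⟩
    obtain ⟨B, hBu⟩ := exists_isMaxBase M u
    have hB : IsMaxBase M w' B := isMaxBase_of_mem_normalCone hw' hBu.1 hBu.mem_face
    by_contra! hcon
    have huniq : ∀ B', IsMaxBase M w' B' → B' = B := fun B' hB' ↦
      hcon _ _ (hB'.of_toTropProj_eq hww') (hB.of_toTropProj_eq hww')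
    refine (one_le_codim_iff _).1 hcodim (eq_top_iff.2 fun v _ ↦ ?_)
    obtain ⟨ε, hε, hmax⟩ := hB.exists_perturb huniq v
    have hmem : w' + ε • v ∈ normalCone (matroidPolytope M) (face (matroidPolytope M) u) := by
      intro x hx y hy
      rw [hB.eq_indicatorVec huniq hx.1 (hw' x hx _ hBu.mem_face.1)]
      exact dotProduct_le_of_mem_matroidPolytope hmax.2 hy
    have := Submodule.sub_mem _ (Submodule.subset_span hmem)
      (Submodule.subset_span (R := ℝ) hw')
    rw [add_sub_cancel_left] at this
    exact (Submodule.smul_mem_iff _ hε.ne').1 this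
  · rintro ⟨B, B', hB, hB', hne⟩
    refine ⟨w, ⟨_, ⟨⟨_, face_nonempty M w, ⟨w, rfl⟩, rfl⟩, ?_⟩, mem_normalCone_face _ w⟩, rfl⟩
    rw [one_le_codim_iff]
    intro htop
    let d : ι → ℝ := indicatorVec B - indicatorVec B'
    have hle : Submodule.span ℝ (normalCone (matroidPolytope M) (face (matroidPolytope M) w)) ≤
        LinearMap.ker (dotProductBilin ℝ ℝ d) := by
      refine Submodule.span_le.2 fun v hv ↦ ?_
      have h1 := hv _ hB.mem_face _ hB'.mem_face.1
      have h2 := hv _ hB'.mem_face _ hB.mem_face.1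
      have : d ⬝ᵥ v = 0 := by
        rw [dotProduct_comm, dotProduct_sub]
        linarith
      simpa using this
    rw [htop] at hle
    have hd : d ⬝ᵥ d = 0 := by simpa using hle (Submodule.mem_top (x := d))
    exact hne (indicatorVec_injective (sub_eq_zero.1 (dotProduct_self_eq_zero.1 hd)))

/-- The Bergman fan of a loopless matroid contains the indicator vector of a set if and only if
this set is a flat. -/
lemma toTropProj_indicatorVec_mem_bergmanFan_iff (hE : M.E = univ) (hM : M.Loopless)
    (F : Set ι) : toTropProj ι (indicatorVec F) ∈ bergmanFan M ↔ M.closure F = F := by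
  have hF : ∀ x ∈ F, ∀ y ∉ F, (indicatorVec F : ι → ℝ) y < indicatorVec F x := by
    intro x hx y hy
    simp [indicatorVec, hx, hy]
  have hFE : F ⊆ M.E := hE ▸ subset_univ F
  rw [toTropProj_mem_bergmanFan_iff]
  constructor
  · refine fun h ↦ subset_antisymm (fun i hi ↦ ?_) (M.subset_closure F)
    by_contra hiF
    obtain ⟨B, hB, hiB⟩ := h i (hE ▸ mem_univ i)
    rw [← hB.closure_inter hE hF] at hi
    exact notMem_closure_of_mem_of_subset hB.1.indep hiB inter_subset_left (hiF ·.2) hi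
  · intro hcl i hi
    obtain ⟨B, hB⟩ := exists_isMaxBase M (indicatorVec F)
    by_cases hiB : i ∈ B
    · exact ⟨B, hB, hiB⟩
    have hBF := hB.closure_inter hE hF
    by_cases hiF : i ∈ F
    -- Looplessness enters here: disjoint parts of a base have disjoint closures, so `i`, spanned by
    -- `B ∩ F`, can be exchanged for an element of `B ∩ F`, which has the same weight.
    · have hdisj : M.closure (B ∩ F) ∩ M.closure (B ∩ Fᶜ) = ∅ := by
        rw [← Indep.closure_inter_eq_inter_closure
          (hB.1.indep.subset (union_subset inter_subset_left inter_subset_left)),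
          ← inter_inter_distrib_left, inter_compl_self, inter_empty, closure_empty,
          hM.loops_eq_empty]
      have hiC : i ∉ M.closure (B ∩ Fᶜ) := fun h ↦ by
        have : i ∈ M.closure (B ∩ F) ∩ M.closure (B ∩ Fᶜ) :=
          ⟨hB.subset_closure_inter hE hF hiF, h⟩
        simp [hdisj] at this
      obtain ⟨f, hfB, hfF, hB'⟩ := exists_exchange_of_notMem_closure_inter hB.1 hi hiC
      rw [notMem_compl_iff] at hfF
      exact ⟨_, hB.exchange hiB hfB (by simp [indicatorVec, hiF, hfF]) hB', mem_insert _ _⟩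
    · have hiC : i ∉ M.closure (B ∩ F) := by rwa [hBF, hcl]
      obtain ⟨f, hfB, hfF, hB'⟩ := exists_exchange_of_notMem_closure_inter hB.1 hi hiC
      exact ⟨_, hB.exchange hiB hfB (by simp [indicatorVec, hiF, hfF]) hB', mem_insert _ _⟩

end BergmanFan

theorem mainTheorem12 {ι : Type*} [Fintype ι] (M₁ M₂ : Matroid ι)
    (hE₁ : M₁.E = Set.univ) (hE₂ : M₂.E = Set.univ)
    (hM₁ : M₁.Loopless) (hM₂ : M₂.Loopless) :
    (BergmanFan.bergmanFan M₁ = BergmanFan.bergmanFan M₂ → M₁ = M₂) ∧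
    (BergmanFan.normalFanSkeleton M₁ = BergmanFan.normalFanSkeleton M₂ → M₁ = M₂) := by
  constructor
  · intro h
    have hflat : ∀ F, M₁.IsFlat F ↔ M₂.IsFlat F := fun F ↦ by
      rw [Matroid.isFlat_iff_closure_eq, Matroid.isFlat_iff_closure_eq,
        ← BergmanFan.toTropProj_indicatorVec_mem_bergmanFan_iff hE₁ hM₁,
        ← BergmanFan.toTropProj_indicatorVec_mem_bergmanFan_iff hE₂ hM₂, h]
    refine Matroid.ext_closure fun X ↦ ?_
    simp only [Matroid.closure_def, hflat, hE₁, hE₂]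
  · intro h
    refine BergmanFan.eq_of_parallelOver_iff hE₁ hE₂ hM₁ hM₂ fun F i j hi hj hij ↦ ?_
    obtain ⟨w, hw, hinj, rfl⟩ := BergmanFan.exists_weight hi hj
    rw [← BergmanFan.exists_isMaxBase_ne_iff hE₁ hij hw hinj,
      ← BergmanFan.exists_isMaxBase_ne_iff hE₂ hij hw hinj,
      ← BergmanFan.toTropProj_mem_normalFanSkeleton_iff,
      ← BergmanFan.toTropProj_mem_normalFanSkeleton_iff, h]
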